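/- Let $\mathbb{U}=\{z\in\mathbb{C}:|z|<1\}$, and let $H^2$ be the Hardy space of $\mathbb{U}$: the Hilbert space of analytic functions $f(z)=\sum_{n\ge 0}a_nz^n$ on $\mathbb{U}$ with $\|f\|^2=\sum_{n\ge 0}|a_n|^2<\infty$. For a bounded analytic function $\varphi$ on $\mathbb{U}$, let $T_\varphi:H^2\to H^2$ be the bounded operator $T_\varphi f=\varphi f$ (the analytic Toeplitz operator with symbol $\varphi$). For bounded linear operators $A,B$ on a Hilbert space $\mathcal{H}$, write $A\propto B$ if there is a bounded linear operator $X\ne 0$ on $\mathcal{H}$ with $XA=BX$. An inner function is a bounded analytic function on $\mathbb{U}$ whose radial limits exist and have modulus $1$ at almost every point of $\partial\mathbb{U}$. **Theorem.** Suppose that $\varphi$ is a nonconstant inner function and $\psi$ is any holomorphic self-map of $\mathbb{U}$ (that is, $\psi$ is holomorphic on $\mathbb{U}$ and $\psi(\mathbb{U})\subset\mathbb{U}$; constant $\psi$ is allowed). Then $T_\varphi\propto T_\psi$. -/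

import Mathlib

open Metric Filter Topology
open scoped Complex.UnitDisc

namespace Hardy

/-! ### The Hardy space `H²` of the open unit disc -/

/-- The sequence space `ℓ²(ℕ)`. -/
abbrev EllTwo : Type := lp (fun _ : ℕ => ℂ) 2

/-- The sum of the power series `∑ aₙ zⁿ`. -/
noncomputable def powerSum (a : ℕ → ℂ) (z : ℂ) : ℂ := ∑' n, a n * z ^ n

theorem hasFPowerSeries_powerSum {a : ℕ → ℂ} {C : ℝ} (ha : ∀ n, ‖a n‖ ≤ C) :
    HasFPowerSeriesOnBall (powerSum a) (FormalMultilinearSeries.ofScalars ℂ a) 0 1 := by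
  have h1 : (1 : ENNReal) ≤ (FormalMultilinearSeries.ofScalars ℂ a).radius := by
    have := (FormalMultilinearSeries.ofScalars ℂ a).le_radius_of_bound C (r := 1) (fun n => by
      simpa using ha n)
    simpa using this
  have h2 := (FormalMultilinearSeries.ofScalars ℂ a).hasFPowerSeriesOnBall
    (lt_of_lt_of_le one_pos h1)
  have h3 := h2.mono one_pos h1
  have h4 : (FormalMultilinearSeries.ofScalars ℂ a).sum = powerSum a := by
    funext z
    simp [FormalMultilinearSeries.sum, powerSum, mul_comm]
  rwa [h4] at h3

theorem hasSum_powerSum {a : ℕ → ℂ} {C : ℝ} (ha : ∀ n, ‖a n‖ ≤ C) {z : ℂ} (hz : ‖z‖ < 1) :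
    HasSum (fun n => a n * z ^ n) (powerSum a z) := by
  have hg : Summable fun n : ℕ => C * ‖z‖ ^ n :=
    (summable_geometric_of_lt_one (norm_nonneg z) hz).mul_left C
  refine (Summable.of_norm_bounded hg fun n => ?_).hasSum
  rw [norm_mul, norm_pow]
  gcongr
  exact ha n

theorem norm_coeff_le (a : EllTwo) (n : ℕ) : ‖a n‖ ≤ ‖a‖ :=
  lp.norm_apply_le_norm two_ne_zero a n

/-- The linear map sending `a ∈ ℓ²` to the function `z ↦ ∑ aₙ zⁿ` on the unit disc. -/
noncomputable def ofCoeff : EllTwo →ₗ[ℂ] (𝔻 → ℂ) where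
  toFun a z := powerSum a z
  map_add' a b := by
    funext z
    have hz : ‖(z : ℂ)‖ < 1 := z.norm_lt_one
    have h := (hasSum_powerSum (norm_coeff_le a) hz).add (hasSum_powerSum (norm_coeff_le b) hz)
    simp only [← add_mul] at h
    exact (hasSum_powerSum (norm_coeff_le (a + b)) hz).unique h
  map_smul' c a := by
    funext z
    have hz : ‖(z : ℂ)‖ < 1 := z.norm_lt_one
    have h := (hasSum_powerSum (norm_coeff_le a) hz).mul_left c
    simp only [← mul_assoc] at h
    exact (hasSum_powerSum (norm_coeff_le (c • a)) hz).unique h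

theorem ofCoeff_injective : Function.Injective ofCoeff := by
  rw [← LinearMap.ker_eq_bot, LinearMap.ker_eq_bot']
  intro a ha
  have hp := (hasFPowerSeries_powerSum (norm_coeff_le a)).hasFPowerSeriesAt
  have h0 : powerSum a =ᶠ[𝓝 0] fun _ => (0 : ℂ) := by
    filter_upwards [ball_mem_nhds (0 : ℂ) one_pos] with z hz
    have hz' : ‖z‖ < 1 := by simpa using hz
    exact congrFun ha (Complex.UnitDisc.mk z hz')
  have hz := (hp.congr h0).eq_zero
  ext n
  have h1 : (FormalMultilinearSeries.ofScalars ℂ (a : ℕ → ℂ)).coeff n = 0 := by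
    rw [hz]
    rfl
  simpa using h1

/-- The functions on the unit disc that are sums of a power series with square-summable
coefficients. -/
noncomputable def hardySubmodule : Submodule ℂ (𝔻 → ℂ) := LinearMap.range ofCoeff

/-- The Hardy space `H²` of the open unit disc: the analytic functions on the disc whose Taylor
coefficients at the origin are square-summable.  (A type of its own, so that it carries the
Hardy norm and not the topology of pointwise convergence.) -/
def H2 : Type := hardySubmodule

namespace H2

noncomputable instance : AddCommGroup H2 := inferInstanceAs (AddCommGroup hardySubmodule)

noncomputable instance : Module ℂ H2 := inferInstanceAs (Module ℂ hardySubmodule)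

/-- The elements of `H²` are functions on the unit disc. -/
instance : CoeFun H2 (fun _ => 𝔻 → ℂ) := ⟨fun f => f.1⟩

/-- `ℓ² ≃ H²`, `a ↦ ∑ aₙ zⁿ`. -/
noncomputable def equivEllTwo : EllTwo ≃ₗ[ℂ] H2 :=
  LinearEquiv.ofInjective ofCoeff ofCoeff_injective

/-- The sequence of Taylor coefficients at the origin. -/
noncomputable def coeff : H2 →ₗ[ℂ] EllTwo := equivEllTwo.symm.toLinearMap

/-- The norm of `H²`: `‖f‖² = ∑ |aₙ|²` for `f(z) = ∑ aₙ zⁿ`. -/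
noncomputable instance : NormedAddCommGroup H2 :=
  NormedAddCommGroup.induced H2 EllTwo coeff equivEllTwo.symm.injective

/-- The inner product of `H²`: the inner product in `ℓ²` of the coefficient sequences. -/
noncomputable instance : InnerProductSpace ℂ H2 := InnerProductSpace.induced coeff

/-- The power series correspondence as an isometry. -/
noncomputable def isometryEllTwo : H2 ≃ₗᵢ[ℂ] EllTwo where
  toLinearEquiv := equivEllTwo.symm
  norm_map' _ := rfl

instance : CompleteSpace H2 :=
  (completeSpace_congr (e := isometryEllTwo.toEquiv) isometryEllTwo.isometry.isUniformEmbedding).2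
    inferInstance

theorem norm_eq (f : H2) : ‖f‖ = ‖coeff f‖ := rfl

@[ext] theorem ext {f g : H2} (h : ∀ z : 𝔻, f z = g z) : f = g := Subtype.ext (funext h)

@[simp] theorem add_apply (f g : H2) (z : 𝔻) : (f + g) z = f z + g z := rfl

@[simp] theorem smul_apply (c : ℂ) (f : H2) (z : 𝔻) : (c • f) z = c * f z := rfl

theorem apply_eq (f : H2) (z : 𝔻) : f z = powerSum (coeff f) z := by
  conv_lhs => rw [← equivEllTwo.apply_symm_apply f]
  rfl

theorem hasSum (f : H2) (z : 𝔻) : HasSum (fun n => coeff f n * (z : ℂ) ^ n) (f z) := by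
  rw [apply_eq]
  exact hasSum_powerSum (norm_coeff_le _) z.norm_lt_one

end H2

/-! ### Analytic Toeplitz operators -/

/-- Bounded holomorphic functions on the unit disc. (The values of `φ` outside the disc play no
role.) -/
def IsBoundedHolomorphic (φ : ℂ → ℂ) : Prop :=
  DifferentiableOn ℂ φ (ball 0 1) ∧ ∃ M : ℝ, ∀ z ∈ ball (0 : ℂ) 1, ‖φ z‖ ≤ M

/-- The mean of `|g|²` over the circle of radius `r`, as a squared `L²` norm, in terms of the
power series coefficients of `g`. -/
theorem tendsto_circle_mean {g : ℂ → ℂ} {c : ℕ → ℂ} (hg : ContinuousOn g (ball 0 1))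
    (hc : ∀ z : ℂ, ‖z‖ < 1 → HasSum (fun n => c n * z ^ n) (g z)) {r : ℝ} (hr0 : 0 ≤ r)
    (hr1 : r < 1) :
    ∃ G : C(AddCircle (1 : ℝ), ℂ), (∀ t, G t = g (r * fourier 1 t)) ∧
      Tendsto (fun N => ∑ n ∈ Finset.range N, (‖c n‖ * r ^ n) ^ 2) atTop
        (𝓝 (‖ContinuousMap.toLp (E := ℂ) 2 AddCircle.haarAddCircle ℂ G‖ ^ 2)) := by
  have hmem : ∀ t : AddCircle (1 : ℝ), ‖(r : ℂ) * fourier 1 t‖ < 1 := by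
    intro t
    rw [fourier_one, norm_mul, Circle.norm_coe, mul_one, Complex.norm_real, Real.norm_eq_abs,
      abs_of_nonneg hr0]
    exact hr1
  have hcont : Continuous fun t : AddCircle (1 : ℝ) => g (r * fourier 1 t) :=
    hg.comp_continuous (by fun_prop) (fun t => by simpa using hmem t)
  refine ⟨⟨_, hcont⟩, fun t => rfl, ?_⟩
  set G : C(AddCircle (1 : ℝ), ℂ) := ⟨_, hcont⟩ with hG
  let v : ℕ → C(AddCircle (1 : ℝ), ℂ) := fun n => (c n * (r : ℂ) ^ n) • fourier (n : ℤ)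
  have hnorm : Summable fun n => ‖c n * (r : ℂ) ^ n‖ :=
    (hc r (by simpa [abs_of_nonneg hr0] using hr1)).summable.norm
  have hv : Summable v := by
    refine Summable.of_norm (hnorm.congr fun n => ?_)
    simp only [v, norm_smul, fourier_norm, mul_one]
  have hsum : HasSum v G := by
    have h := hv.hasSum
    have hEq : ∑' n, v n = G := by
      ext t
      have h1 : HasSum (fun n => v n t) ((∑' n, v n) t) :=
        ContinuousMap.hasSum_apply h t
      refine h1.unique ?_
      refine (hc _ (hmem t)).congr_fun ?_
      intro n
      simp only [v, ContinuousMap.smul_apply, smul_eq_mul, mul_pow, mul_assoc]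
      congr 2
      simp [fourier_apply, AddCircle.toCircle_nsmul]
    rwa [hEq] at h
  have hL := (hsum.mapL (ContinuousMap.toLp (E := ℂ) 2
    (AddCircle.haarAddCircle (T := (1 : ℝ))) ℂ)).tendsto_sum_nat
  have hL2 := (hL.norm).pow 2
  refine hL2.congr fun N => ?_
  have ho : Orthonormal ℂ fun n : ℕ => fourierLp (T := (1 : ℝ)) 2 (n : ℤ) :=
    orthonormal_fourier.comp _ Nat.cast_injective
  have hi := ho.inner_sum (fun n => c n * (r : ℂ) ^ n) (fun n => c n * (r : ℂ) ^ n)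
    (Finset.range N)
  simp only [v, map_smul]
  rw [@norm_sq_eq_re_inner ℂ]
  rw [hi, map_sum]
  refine Finset.sum_congr rfl fun n _ => ?_
  rw [RCLike.conj_mul]
  norm_cast
  simp [abs_of_nonneg hr0]

/-- Multiplication by a bounded holomorphic function maps `H²` boundedly into itself. -/
theorem exists_mul {φ : ℂ → ℂ} (hφ : DifferentiableOn ℂ φ (ball 0 1)) {M : ℝ}
    (hM : ∀ z ∈ ball (0 : ℂ) 1, ‖φ z‖ ≤ M) (f : H2) :
    ∃ g : H2, (∀ z : 𝔻, g z = φ z * f z) ∧ ‖g‖ ≤ M * ‖f‖ := by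
  have hM0 : 0 ≤ M := (norm_nonneg _).trans (hM 0 (by simp))
  set a := H2.coeff f with ha
  set F : ℂ → ℂ := powerSum a with hF
  have hFd : DifferentiableOn ℂ F (ball 0 1) := by
    have h := (hasFPowerSeries_powerSum (norm_coeff_le a)).differentiableOn
    have hb : eball (0 : ℂ) 1 = ball 0 1 := by
      simpa using (eball_coe (x := (0 : ℂ)) (ε := 1))
    rwa [hb] at h
  have hGd : DifferentiableOn ℂ (fun z => φ z * F z) (ball 0 1) := hφ.mul hFd
  let c : ℕ → ℂ := fun n => (n.factorial : ℂ)⁻¹ * iteratedDeriv n (fun z => φ z * F z) 0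
  have hc : ∀ z : ℂ, ‖z‖ < 1 → HasSum (fun n => c n * z ^ n) (φ z * F z) := by
    intro z hz
    have h := Complex.hasSum_taylorSeries_on_ball (c := 0) hGd (z := z) (by simpa using hz)
    refine h.congr_fun fun n => ?_
    simp only [c, smul_eq_mul, sub_zero]
    ring
  have key : ∀ r : ℝ, 0 ≤ r → r < 1 → ∀ N,
      ∑ n ∈ Finset.range N, (‖c n‖ * r ^ n) ^ 2 ≤ (M * ‖a‖) ^ 2 := by
    intro r hr0 hr1 N
    obtain ⟨G, hGt, hGl⟩ := tendsto_circle_mean hGd.continuousOn hc hr0 hr1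
    obtain ⟨K, hKt, hKl⟩ := tendsto_circle_mean hFd.continuousOn
      (fun z hz => hasSum_powerSum (norm_coeff_le a) hz) hr0 hr1
    have hs : Summable fun n => ‖a n‖ ^ 2 := by
      simpa using (lp.memℓp a).summable (by norm_num)
    have hna : ‖a‖ ^ 2 = ∑' n, ‖a n‖ ^ 2 := by
      simpa using lp.norm_rpow_eq_tsum (p := 2) (by norm_num) a
    have h1 : ‖ContinuousMap.toLp (E := ℂ) 2 AddCircle.haarAddCircle ℂ K‖ ^ 2 ≤ ‖a‖ ^ 2 := by
      refine le_of_tendsto hKl (Eventually.of_forall fun N => ?_)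
      rw [hna]
      refine le_trans (Finset.sum_le_sum fun n _ => ?_) (hs.sum_le_tsum _ fun n _ => sq_nonneg _)
      gcongr
      exact mul_le_of_le_one_right (norm_nonneg _) (pow_le_one₀ hr0 hr1.le)
    have h1' := (sq_le_sq₀ (norm_nonneg _) (norm_nonneg _)).1 h1
    have h2 : ‖ContinuousMap.toLp (E := ℂ) 2 AddCircle.haarAddCircle ℂ G‖ ≤
        M * ‖ContinuousMap.toLp (E := ℂ) 2 AddCircle.haarAddCircle ℂ K‖ := by
      refine MeasureTheory.Lp.norm_le_mul_norm_of_ae_le_mul ?_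
      filter_upwards [ContinuousMap.coeFn_toLp (p := 2) (𝕜 := ℂ) AddCircle.haarAddCircle G,
        ContinuousMap.coeFn_toLp (p := 2) (𝕜 := ℂ) AddCircle.haarAddCircle K] with t e1 e2
      rw [e1, e2, hGt, hKt, norm_mul]
      gcongr
      apply hM
      rw [mem_ball_zero_iff, fourier_one, norm_mul, Circle.norm_coe, mul_one, Complex.norm_real,
        Real.norm_eq_abs, abs_of_nonneg hr0]
      exact hr1
    have hmono : Monotone fun N => ∑ n ∈ Finset.range N, (‖c n‖ * r ^ n) ^ 2 := fun A B hAB =>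
      Finset.sum_le_sum_of_subset_of_nonneg (Finset.range_mono hAB) fun n _ _ => sq_nonneg _
    refine (hmono.ge_of_tendsto hGl N).trans ?_
    gcongr
    exact h2.trans (by gcongr)
  have key1 : ∀ N, ∑ n ∈ Finset.range N, ‖c n‖ ^ 2 ≤ (M * ‖a‖) ^ 2 := by
    intro N
    have ht : Tendsto (fun r : ℝ => ∑ n ∈ Finset.range N, (‖c n‖ * r ^ n) ^ 2) (𝓝[<] 1)
        (𝓝 (∑ n ∈ Finset.range N, (‖c n‖ * 1 ^ n) ^ 2)) := by
      refine Tendsto.mono_left (Continuous.tendsto ?_ 1) nhdsWithin_le_nhds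
      fun_prop
    simp only [one_pow, mul_one] at ht
    refine le_of_tendsto ht ?_
    filter_upwards [Ioo_mem_nhdsLT (zero_lt_one (α := ℝ))] with r hr
    exact key r hr.1.le hr.2 N
  have hcs : Summable fun n => ‖c n‖ ^ 2 :=
    summable_of_sum_range_le (fun n => sq_nonneg _) key1
  have hcm : Memℓp c 2 := memℓp_gen (by simpa using hcs)
  let b : EllTwo := ⟨c, hcm⟩
  refine ⟨H2.equivEllTwo b, fun z => ?_, ?_⟩
  · have h1 : (H2.equivEllTwo b : H2) z = powerSum c z := rfl
    rw [h1, H2.apply_eq f z]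
    exact (hc z z.norm_lt_one).tsum_eq
  · have h1 : ‖H2.equivEllTwo b‖ = ‖b‖ := by
      rw [H2.norm_eq]
      exact congrArg norm (H2.equivEllTwo.symm_apply_apply b)
    rw [h1, H2.norm_eq f]
    refine (sq_le_sq₀ (norm_nonneg _) (by positivity)).1 ?_
    have hnb : ‖b‖ ^ 2 = ∑' n, ‖c n‖ ^ 2 := by
      simpa using lp.norm_rpow_eq_tsum (p := 2) (by norm_num) b
    rw [hnb]
    exact Real.tsum_le_of_sum_range_le (fun n => sq_nonneg _) key1

theorem mul_mem {φ : ℂ → ℂ} (hφ : IsBoundedHolomorphic φ) (f : H2) :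
    (fun z : 𝔻 => φ z * f z) ∈ hardySubmodule := by
  obtain ⟨hd, M, hM⟩ := hφ
  obtain ⟨g, hg, -⟩ := exists_mul hd hM f
  have : (fun z : 𝔻 => φ z * f z) = g.1 := (funext hg).symm
  rw [this]
  exact g.2

/-- The analytic Toeplitz operator `T_φ : H² → H²`, `T_φ f = φ f`, as a bounded operator. -/
noncomputable def toeplitz (φ : ℂ → ℂ) (hφ : IsBoundedHolomorphic φ) : H2 →L[ℂ] H2 :=
  LinearMap.mkContinuousOfExistsBound
    { toFun := fun f => (⟨fun z : 𝔻 => φ z * f z, mul_mem hφ f⟩ : hardySubmodule)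
      map_add' := fun f g => H2.ext fun z => mul_add (φ z) (f z) (g z)
      map_smul' := fun c f => H2.ext fun z => mul_left_comm (φ z) c (f z) }
    (by
      obtain ⟨hd, M, hM⟩ := hφ
      refine ⟨M, fun f => ?_⟩
      obtain ⟨g, hg, hn⟩ := exists_mul hd hM f
      refine le_trans (le_of_eq (congrArg norm ?_)) hn
      exact H2.ext fun z => (hg z).symm)

@[simp] theorem toeplitz_apply (φ : ℂ → ℂ) (hφ : IsBoundedHolomorphic φ) (f : H2) (z : 𝔻) :
    toeplitz φ hφ f z = φ z * f z := rfl

/-! ### Intertwining, inner functions, self-maps of the disc -/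

/-- The bounded operator `X` intertwines `A` and `B`: `X A = B X` and `X ≠ 0`. -/
def Intertwines {H : Type*} [NormedAddCommGroup H] [InnerProductSpace ℂ H]
    (X A B : H →L[ℂ] H) : Prop :=
  X ∘L A = B ∘L X ∧ X ≠ 0

/-- The relation `A ∝ B`: some bounded operator intertwines `A` and `B`, in this order. -/
def IsIntertwinedWith {H : Type*} [NormedAddCommGroup H] [InnerProductSpace ℂ H]
    (A B : H →L[ℂ] H) : Prop :=
  ∃ X : H →L[ℂ] H, Intertwines X A B

/-- Inner functions: bounded holomorphic functions on the unit disc whose radial limits exist and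
have modulus `1` at almost every point of the unit circle. -/
def IsInner (φ : ℂ → ℂ) : Prop :=
  IsBoundedHolomorphic φ ∧
    ∀ᵐ θ : ℝ, ∃ w : ℂ, ‖w‖ = 1 ∧
      Tendsto (fun r : ℝ => φ (r * Complex.exp (θ * Complex.I))) (𝓝[<] 1) (𝓝 w)

/-- Holomorphic self-maps of the open unit disc. -/
def IsHolomorphicSelfMap (ψ : ℂ → ℂ) : Prop :=
  DifferentiableOn ℂ ψ (ball 0 1) ∧ Set.MapsTo ψ (ball 0 1) (ball 0 1)

theorem IsHolomorphicSelfMap.isBoundedHolomorphic {ψ : ℂ → ℂ} (h : IsHolomorphicSelfMap ψ) :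
    IsBoundedHolomorphic ψ :=
  ⟨h.1, 1, fun _ hz => (mem_ball_zero_iff.1 (h.2 hz)).le⟩

end Hardy

/-!
If `φ` is a nonconstant inner function, then `T_φ` is an isometry of `H²`, and
`e = 1 - conj (φ 0) • φ` is a nonzero vector orthogonal to its range. Hence the iterates `T_φⁿ e`
are orthogonal, and after normalising `e` one may try

  `X f = ∑ₙ ⟪T_φⁿ e, f⟫ T_ψⁿ 1`.

Formally `X T_φ = T_ψ X`, because `⟪e, T_φ f⟫ = 0` and `⟪T_φⁿ⁺¹ e, T_φ f⟫ = ⟪T_φⁿ e, f⟫`; also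
`X e = 1`, so `X ≠ 0`. What has to be shown is boundedness, that is,
`‖∑ cₙ T_ψⁿ 1‖² ≤ ∑ |cₙ|²`. When `ψ 0 = 0` this is Littlewood's subordination argument:
`T_ψ` is a contraction whose range is orthogonal to `1`, so the bound follows by splitting off the
constant term and inducting (`norm_sq_sum_iterate_le`). This part is pure Hilbert space theory,
`exists_intertwining_of_wandering`.

The general case reduces to `ψ 0 = 0` by the disc automorphism `b` that carries `ψ 0` to `0`:
`b ∘ φ` is again inner and nonconstant, and since `φ` is recovered from `b ∘ φ` by a fractional
linear map, an operator that intertwines `T_{b ∘ φ}` and `T_{b ∘ ψ}` also intertwines `T_φ` and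
`T_ψ` (`intertwines_of_discAut`).

That `T_φ` is isometric (`norm_toeplitz_of_isInner`) comes from the circle means of `|f|²`, which
tend to `‖f‖²`: for bounded `f` dominated convergence shows that the means of `|f|² (1 - |φ|²)`
tend to `0`, and polynomials are dense. The bound `|φ| ≤ 1`, needed for `b ∘ φ` to make sense, then
follows from `‖φⁿ‖ = 1` and the continuity of point evaluations.
-/

/-! ### Isometries with a wandering vector, and contractions -/

section Hilbert
open scoped InnerProductSpace
variable {H : Type*} [NormedAddCommGroup H] [InnerProductSpace ℂ H]

theorem orthonormal_iterate (V : H →L[ℂ] H) (hV : ∀ f, ‖V f‖ = ‖f‖) {e : H} (he : ‖e‖ = 1)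
    (hperp : ∀ f, ⟪e, V f⟫_ℂ = 0) : Orthonormal ℂ fun n : ℕ => (V ^ n) e := by
  have hinner : ∀ f g, ⟪V f, V g⟫_ℂ = ⟪f, g⟫_ℂ := fun f g =>
    LinearIsometry.inner_map_map ⟨V.toLinearMap, hV⟩ f g
  have hpow : ∀ (n : ℕ) f g, ⟪(V ^ n) f, (V ^ n) g⟫_ℂ = ⟪f, g⟫_ℂ := by
    intro n
    induction n with
    | zero => intro f g; rfl
    | succ n ih =>
      intro f g
      rw [pow_succ', mul_apply_eq_comp, mul_apply_eq_comp, hinner, ih]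
  have hlt : ∀ m k : ℕ, ⟪(V ^ m) e, (V ^ (m + k + 1)) e⟫_ℂ = 0 := by
    intro m k
    rw [add_assoc, pow_add, mul_apply_eq_comp, hpow, pow_succ',
      mul_apply_eq_comp, hperp]
  rw [orthonormal_iff_ite]
  intro m n
  rcases lt_trichotomy m n with h | rfl | h
  · obtain ⟨k, rfl⟩ := Nat.exists_eq_add_of_lt h
    rw [if_neg (by omega), hlt]
  · rw [if_pos rfl, hpow, inner_self_eq_norm_sq_to_K, he]
    simp
  · obtain ⟨k, rfl⟩ := Nat.exists_eq_add_of_lt h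
    rw [if_neg (by omega), inner_eq_zero_symm, hlt]

/-- Littlewood's inequality in operator form. With `T = T_ψ` for a self-map `ψ` of the disc fixing
`0`, and `u = 1`, it bounds the composition `p ↦ p ∘ ψ` on polynomials. -/
theorem norm_sq_sum_iterate_le (T : H →L[ℂ] H) (hT : ∀ f, ‖T f‖ ≤ ‖f‖) {u : H} (hu : ‖u‖ ≤ 1)
    (hperp : ∀ f, ⟪u, T f⟫_ℂ = 0) (N : ℕ) (c : ℕ → ℂ) :
    ‖∑ n ∈ Finset.range N, c n • (T ^ n) u‖ ^ 2 ≤ ∑ n ∈ Finset.range N, ‖c n‖ ^ 2 := by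
  induction N generalizing c with
  | zero => simp
  | succ N ih =>
    -- Horner: split off the constant term, which is orthogonal to the rest.
    have hsum : ∑ n ∈ Finset.range (N + 1), c n • (T ^ n) u =
        c 0 • u + T (∑ n ∈ Finset.range N, c (n + 1) • (T ^ n) u) := by
      rw [Finset.sum_range_succ', map_sum, add_comm]
      simp [pow_succ']
    have horth : ⟪c 0 • u, T (∑ n ∈ Finset.range N, c (n + 1) • (T ^ n) u)⟫_ℂ = 0 := by
      rw [inner_smul_left, hperp, mul_zero]
    rw [hsum, sq, norm_add_sq_eq_norm_sq_add_norm_sq_of_inner_eq_zero _ _ horth,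
      Finset.sum_range_succ', add_comm, ← sq, ← sq]
    refine add_le_add ((pow_le_pow_left₀ (norm_nonneg _) (hT _) 2).trans (ih _)) ?_
    rw [norm_smul]
    exact pow_le_pow_left₀ (by positivity) (mul_le_of_le_one_right (norm_nonneg _) hu) 2

theorem summable_iterate [CompleteSpace H] (T : H →L[ℂ] H) (hT : ∀ f, ‖T f‖ ≤ ‖f‖) {u : H}
    (hu : ‖u‖ ≤ 1) (hperp : ∀ f, ⟪u, T f⟫_ℂ = 0) {c : ℕ → ℂ} (hc : Summable fun n => ‖c n‖ ^ 2) :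
    Summable fun n => c n • (T ^ n) u := by
  have hfin : ∀ s : Finset ℕ, ‖∑ n ∈ s, c n • (T ^ n) u‖ ^ 2 ≤ ∑ n ∈ s, ‖c n‖ ^ 2 := by
    intro s
    obtain ⟨N, hN⟩ := s.exists_nat_subset_range
    have h := norm_sq_sum_iterate_le T hT hu hperp N fun n => if n ∈ s then c n else 0
    simpa [ite_smul, Finset.sum_ite_mem, Finset.inter_eq_right.2 hN, apply_ite norm, ite_pow]
      using h
  rw [summable_iff_vanishing_norm]
  intro ε hε
  obtain ⟨s, hs⟩ := summable_iff_vanishing_norm.1 hc (ε ^ 2) (by positivity)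
  refine ⟨s, fun t ht => ?_⟩
  have h1 := hs t ht
  rw [Real.norm_of_nonneg (Finset.sum_nonneg fun _ _ => sq_nonneg _)] at h1
  exact lt_of_pow_lt_pow_left₀ 2 hε.le ((hfin t).trans_lt h1)

/-- The operator `X f = ∑ₙ ⟪Vⁿ e, f⟫ Tⁿ u` is bounded by Bessel's inequality for the orthonormal
sequence `Vⁿ e` together with `norm_sq_sum_iterate_le`. -/
theorem exists_intertwining_of_wandering [CompleteSpace H] (V T : H →L[ℂ] H)
    (hV : ∀ f, ‖V f‖ = ‖f‖) {e : H} (he : ‖e‖ = 1) (hVe : ∀ f, ⟪e, V f⟫_ℂ = 0)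
    (hT : ∀ f, ‖T f‖ ≤ ‖f‖) {u : H} (hu : ‖u‖ ≤ 1) (hTu : ∀ f, ⟪u, T f⟫_ℂ = 0) :
    ∃ X : H →L[ℂ] H, X ∘L V = T ∘L X ∧ X e = u := by
  have ho := orthonormal_iterate V hV he hVe
  have hcs : ∀ f, Summable fun n => ‖⟪(V ^ n) e, f⟫_ℂ‖ ^ 2 := fun f =>
    ho.inner_products_summable f
  have hs : ∀ f, Summable fun n => ⟪(V ^ n) e, f⟫_ℂ • (T ^ n) u := fun f =>
    summable_iterate T hT hu hTu (hcs f)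
  let X : H →L[ℂ] H := LinearMap.mkContinuous
    { toFun := fun f => ∑' n, ⟪(V ^ n) e, f⟫_ℂ • (T ^ n) u
      map_add' := fun f g => by
        simp only [inner_add_right, add_smul]
        exact (hs f).tsum_add (hs g)
      map_smul' := fun a f => by
        simp only [inner_smul_right, mul_smul, RingHom.id_apply]
        exact (hs f).tsum_const_smul a } 1 (fun f => by
      rw [one_mul]
      refine (sq_le_sq₀ (norm_nonneg _) (norm_nonneg _)).1 ?_
      refine le_of_tendsto (((hs f).hasSum.tendsto_sum_nat.norm).pow 2)
        (Eventually.of_forall fun N => ?_)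
      exact (norm_sq_sum_iterate_le T hT hu hTu N _).trans (ho.sum_inner_products_le f))
  have hX : ∀ f, X f = ∑' n, ⟪(V ^ n) e, f⟫_ℂ • (T ^ n) u := fun f => rfl
  refine ⟨X, ?_, ?_⟩
  · ext f
    rw [ContinuousLinearMap.comp_apply, ContinuousLinearMap.comp_apply, hX, hX, T.map_tsum (hs f),
      (hs (V f)).tsum_eq_zero_add]
    have h0 : ⟪(V ^ 0) e, V f⟫_ℂ = 0 := hVe f
    rw [h0, zero_smul, zero_add]
    refine tsum_congr fun n => ?_
    rw [pow_succ', pow_succ', mul_apply_eq_comp, mul_apply_eq_comp,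
      map_smul]
    congr 1
    exact LinearIsometry.inner_map_map ⟨V.toLinearMap, hV⟩ _ f
  · rw [hX, tsum_eq_single 0]
    · simp [inner_self_eq_norm_sq_to_K, he]
    · intro n hn
      have h := ho.2 hn
      simp only [pow_zero, one_apply_eq_self] at h
      rw [h, zero_smul]

end Hilbert

/-! ### Circle means and the Hardy norm -/

namespace Hardy
open scoped InnerProductSpace ComplexConjugate Real

namespace H2

theorem powerSum_coeff_toeplitz {φ : ℂ → ℂ} (hφ : IsBoundedHolomorphic φ) (f : H2) {z : ℂ}
    (hz : ‖z‖ < 1) :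
    powerSum (coeff (toeplitz φ hφ f)) z = φ z * powerSum (coeff f) z := by
  have h := toeplitz_apply φ hφ f (Complex.UnitDisc.mk z hz)
  rwa [apply_eq, apply_eq] at h

theorem continuousOn_powerSum_coeff (f : H2) : ContinuousOn (powerSum (coeff f)) (ball 0 1) := by
  have h := (hasFPowerSeries_powerSum (norm_coeff_le (coeff f))).continuousOn
  have hb : eball (0 : ℂ) 1 = ball 0 1 := by
    simpa using (eball_coe (x := (0 : ℂ)) (ε := 1))
  rwa [hb] at h

theorem summable_norm_coeff_sq (f : H2) : Summable fun n => ‖coeff f n‖ ^ 2 := by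
  simpa using (lp.memℓp (coeff f)).summable (by norm_num)

theorem norm_sq_eq_tsum (f : H2) : ‖f‖ ^ 2 = ∑' n, ‖coeff f n‖ ^ 2 := by
  rw [norm_eq]
  simpa using lp.norm_rpow_eq_tsum (p := 2) (by norm_num) (coeff f)

end H2

theorem norm_mul_exp_I_lt_one {r : ℝ} (hr : r ∈ Set.Ioo (0 : ℝ) 1) (θ : ℝ) :
    ‖(r : ℂ) * Complex.exp (θ * Complex.I)‖ < 1 := by
  rw [norm_mul, Complex.norm_exp_ofReal_mul_I, mul_one, Complex.norm_real, Real.norm_eq_abs,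
    abs_of_pos hr.1]
  exact hr.2

theorem continuous_comp_circle {g : ℂ → ℂ} (hg : ContinuousOn g (ball 0 1)) {r : ℝ}
    (hr : r ∈ Set.Ioo (0 : ℝ) 1) :
    Continuous fun θ : ℝ => g (r * Complex.exp (θ * Complex.I)) :=
  hg.comp_continuous (by fun_prop) fun θ => by simpa using norm_mul_exp_I_lt_one hr θ

theorem hasSum_circle_mean (f : H2) {r : ℝ} (hr : r ∈ Set.Ioo (0 : ℝ) 1) :
    HasSum (fun n => (‖H2.coeff f n‖ * r ^ n) ^ 2) ((2 * π)⁻¹ *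
      ∫ θ in (0 : ℝ)..2 * π, ‖powerSum (H2.coeff f) (r * Complex.exp (θ * Complex.I))‖ ^ 2) := by
  obtain ⟨G, hG, hlim⟩ := tendsto_circle_mean (H2.continuousOn_powerSum_coeff f)
    (fun z hz => hasSum_powerSum (norm_coeff_le (H2.coeff f)) hz) hr.1.le hr.2
  rw [hasSum_iff_tendsto_nat_of_nonneg (fun n => sq_nonneg _)]
  convert hlim using 2
  have h1 : ‖ContinuousMap.toLp (E := ℂ) 2 AddCircle.haarAddCircle ℂ G‖ ^ 2 =
      ∫ t : AddCircle (1 : ℝ), ‖G t‖ ^ 2 ∂AddCircle.haarAddCircle := by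
    have h : ((‖ContinuousMap.toLp (E := ℂ) 2 AddCircle.haarAddCircle ℂ G‖ ^ 2 : ℝ) : ℂ) =
        ((∫ t : AddCircle (1 : ℝ), ‖G t‖ ^ 2 ∂AddCircle.haarAddCircle : ℝ) : ℂ) := by
      rw [← integral_complex_ofReal]
      push_cast
      rw [← Complex.coe_algebraMap]
      rw [← inner_self_eq_norm_sq_to_K (𝕜 := ℂ), MeasureTheory.ContinuousMap.inner_toLp]
      simp [Complex.mul_conj']
    exact_mod_cast h
  have h2 : ∀ θ : ℝ, ‖G ((θ : ℝ) : AddCircle (1 : ℝ))‖ ^ 2 =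
      ‖powerSum (H2.coeff f) (r * Complex.exp (((2 * π * θ : ℝ) : ℂ) * Complex.I))‖ ^ 2 := by
    intro θ
    rw [hG, fourier_coe_apply]
    congr 5
    push_cast
    ring
  rw [h1, AddCircle.integral_haarAddCircle, ← AddCircle.intervalIntegral_preimage 1 0]
  simp only [h2]
  rw [intervalIntegral.integral_comp_mul_left (fun θ : ℝ =>
    ‖powerSum (H2.coeff f) (r * Complex.exp ((θ : ℂ) * Complex.I))‖ ^ 2) (by positivity)]
  simp

theorem Ioo_zero_one_mem_nhdsLT : ∀ᶠ r : ℝ in 𝓝[<] 1, r ∈ Set.Ioo (0 : ℝ) 1 :=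
  Ioo_mem_nhdsLT zero_lt_one

theorem tendsto_circle_mean_norm_sq (f : H2) :
    Tendsto (fun r : ℝ => (2 * π)⁻¹ *
      ∫ θ in (0 : ℝ)..2 * π, ‖powerSum (H2.coeff f) (r * Complex.exp (θ * Complex.I))‖ ^ 2)
      (𝓝[<] 1) (𝓝 (‖f‖ ^ 2)) := by
  have h : Tendsto (fun r : ℝ => ∑' n, (‖H2.coeff f n‖ * r ^ n) ^ 2) (𝓝[<] 1)
      (𝓝 (∑' n, ‖H2.coeff f n‖ ^ 2)) := by
    refine tendsto_tsum_of_dominated_convergence (H2.summable_norm_coeff_sq f) (fun n => ?_) ?_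
    · have hc : Continuous fun r : ℝ => (‖H2.coeff f n‖ * r ^ n) ^ 2 := by fun_prop
      have := hc.tendsto 1
      simp only [one_pow, mul_one] at this
      exact this.mono_left nhdsWithin_le_nhds
    · filter_upwards [Ioo_zero_one_mem_nhdsLT] with r hr n
      rw [Real.norm_of_nonneg (sq_nonneg _)]
      have := hr.1.le
      gcongr
      exact mul_le_of_le_one_right (norm_nonneg _) (pow_le_one₀ hr.1.le hr.2.le)
  rw [H2.norm_sq_eq_tsum]
  refine h.congr' ?_
  filter_upwards [Ioo_zero_one_mem_nhdsLT] with r hr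
  exact (hasSum_circle_mean f hr).tsum_eq

/-- For bounded `f`, the circle means of `|f|² - |φ f|² = |f|² (1 - |φ|²)` tend to `0` by dominated
convergence, since `|φ| → 1` radially almost everywhere. -/
theorem norm_toeplitz_of_isInner_of_bounded {φ : ℂ → ℂ} (hφ : IsInner φ) (f : H2) {C : ℝ}
    (hC : ∀ z : ℂ, ‖z‖ < 1 → ‖powerSum (H2.coeff f) z‖ ≤ C) :
    ‖toeplitz φ hφ.1 f‖ = ‖f‖ := by
  obtain ⟨⟨hd, M, hM⟩, hlim⟩ := id hφ
  set F : ℂ → ℂ := powerSum (H2.coeff f) with hF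
  have hFc := H2.continuousOn_powerSum_coeff f
  have h1 := (tendsto_circle_mean_norm_sq f).sub (tendsto_circle_mean_norm_sq (toeplitz φ hφ.1 f))
  have h2 : Tendsto (fun r : ℝ => (2 * π)⁻¹ * ∫ θ in (0 : ℝ)..2 * π,
      ‖F (r * Complex.exp (θ * Complex.I))‖ ^ 2 *
        (1 - ‖φ (r * Complex.exp (θ * Complex.I))‖ ^ 2)) (𝓝[<] 1)
      (𝓝 ((2 * π)⁻¹ * ∫ θ in (0 : ℝ)..2 * π, 0)) := by
    refine Tendsto.const_mul _ (intervalIntegral.tendsto_integral_filter_of_dominated_convergence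
      (fun _ => C ^ 2 * (1 + M ^ 2)) ?_ ?_ intervalIntegrable_const ?_)
    · filter_upwards [Ioo_zero_one_mem_nhdsLT] with r hr
      have c1 := continuous_comp_circle hFc hr
      have c2 := continuous_comp_circle hd.continuousOn hr
      exact ((c1.norm.pow 2).mul (continuous_const.sub (c2.norm.pow 2))).aestronglyMeasurable
    · filter_upwards [Ioo_zero_one_mem_nhdsLT] with r hr
      refine Eventually.of_forall fun θ _ => ?_
      have hz := norm_mul_exp_I_lt_one hr θ
      rw [norm_mul, Real.norm_of_nonneg (sq_nonneg _)]
      refine mul_le_mul (pow_le_pow_left₀ (norm_nonneg _) (hC _ hz) 2) ?_ (norm_nonneg _)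
        (sq_nonneg _)
      refine (norm_sub_le _ _).trans ?_
      rw [norm_one, Real.norm_of_nonneg (sq_nonneg _)]
      gcongr
      exact hM _ (by simpa using hz)
    · filter_upwards [hlim] with θ hθ _
      obtain ⟨w, hw, ht⟩ := hθ
      have h3 : Tendsto (fun r : ℝ => 1 - ‖φ (r * Complex.exp (θ * Complex.I))‖ ^ 2) (𝓝[<] 1)
          (𝓝 0) := by
        have := (ht.norm.pow 2).const_sub 1
        rwa [hw, one_pow, sub_self] at this
      refine h3.zero_mul_isBoundedUnder_le ?_ |>.congr fun r => mul_comm _ _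
      refine isBoundedUnder_of_eventually_le (a := C ^ 2) ?_
      filter_upwards [Ioo_zero_one_mem_nhdsLT] with r hr
      simp only [Function.comp_apply]
      rw [Real.norm_of_nonneg (sq_nonneg _)]
      exact pow_le_pow_left₀ (norm_nonneg _) (hC _ (norm_mul_exp_I_lt_one hr θ)) 2
  rw [intervalIntegral.integral_zero, mul_zero] at h2
  have h3 := tendsto_nhds_unique h1 (h2.congr' (by
    filter_upwards [Ioo_zero_one_mem_nhdsLT] with r hr
    have c1 := continuous_comp_circle hFc hr
    have c3 := continuous_comp_circle (H2.continuousOn_powerSum_coeff (toeplitz φ hφ.1 f)) hr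
    have d1 : Continuous fun θ : ℝ => ‖F (r * Complex.exp (θ * Complex.I))‖ ^ 2 := c1.norm.pow 2
    have d3 : Continuous fun θ : ℝ => ‖powerSum (H2.coeff (toeplitz φ hφ.1 f))
      (r * Complex.exp (θ * Complex.I))‖ ^ 2 := c3.norm.pow 2
    rw [← mul_sub, ← intervalIntegral.integral_sub (d1.intervalIntegrable _ _)
      (d3.intervalIntegrable _ _)]
    congr 1
    refine intervalIntegral.integral_congr fun θ _ => ?_
    simp only
    rw [H2.powerSum_coeff_toeplitz hφ.1 f (norm_mul_exp_I_lt_one hr θ), norm_mul, ← hF]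
    ring))
  exact ((sq_eq_sq₀ (norm_nonneg _) (norm_nonneg _)).1 (sub_eq_zero.1 h3)).symm

theorem norm_toeplitz_of_isInner {φ : ℂ → ℂ} (hφ : IsInner φ) (f : H2) :
    ‖toeplitz φ hφ.1 f‖ = ‖f‖ := by
  -- The Taylor polynomials of `f` are bounded on the disc and converge to `f` in `H²`.
  let p : ℕ → EllTwo := fun N => ∑ n ∈ Finset.range N, lp.single 2 n (H2.coeff f n)
  have hp : Tendsto (fun N => H2.isometryEllTwo.symm (p N)) atTop (𝓝 f) := by
    have h1 : Tendsto p atTop (𝓝 (H2.coeff f)) :=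
      (lp.hasSum_single (by norm_num) (H2.coeff f)).tendsto_sum_nat
    have h2 := (H2.isometryEllTwo.symm.continuous.tendsto _).comp h1
    rwa [show H2.isometryEllTwo.symm (H2.coeff f) = f from
      H2.isometryEllTwo.symm_apply_apply f] at h2
  refine tendsto_nhds_unique (((toeplitz φ hφ.1).continuous.tendsto f).comp hp).norm
    (hp.norm.congr fun N => ?_)
  have hcoeff : H2.coeff (H2.isometryEllTwo.symm (p N)) = p N :=
    H2.isometryEllTwo.apply_symm_apply (p N)
  have hpn : ∀ n, p N n = if n ∈ Finset.range N then H2.coeff f n else 0 := by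
    intro n
    simp only [p, lp.coeFn_sum]
    refine (Finset.sum_apply n _ _).trans ?_
    simp [lp.single_apply, Pi.single_apply]
  refine (norm_toeplitz_of_isInner_of_bounded hφ _
    (C := ∑ n ∈ Finset.range N, ‖H2.coeff f n‖) fun z hz => ?_).symm
  rw [hcoeff, powerSum, tsum_eq_sum (s := Finset.range N) fun n hn => by
    rw [hpn, if_neg hn, zero_mul]]
  refine (norm_sum_le _ _).trans (Finset.sum_le_sum fun n hn => ?_)
  rw [hpn, if_pos hn, norm_mul, norm_pow]
  exact mul_le_of_le_one_right (norm_nonneg _) (pow_le_one₀ (norm_nonneg _) hz.le)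


/-! ### Inner symbols and self-maps fixing the origin -/

namespace H2

/-- The constant function `1`, as an element of `H²`. -/
noncomputable def constOne : H2 := equivEllTwo (lp.single 2 0 1)

theorem coeff_constOne : coeff constOne = lp.single 2 0 1 :=
  equivEllTwo.symm_apply_apply _

theorem norm_constOne : ‖constOne‖ = 1 := by
  rw [norm_eq, coeff_constOne, lp.norm_single (by norm_num), norm_one]

theorem constOne_apply (z : 𝔻) : constOne z = 1 := by
  rw [apply_eq, coeff_constOne, powerSum, tsum_eq_single 0]
  · simp [lp.single_apply]
  · intro n hn
    simp [lp.single_apply, hn]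

theorem coeff_zero (f : H2) : coeff f 0 = f 0 := by
  refine HasSum.unique ?_ (hasSum f 0)
  convert hasSum_single (f := fun n => coeff f n * ((0 : 𝔻) : ℂ) ^ n) 0 (fun n hn => by
    simp [hn]) using 1
  simp

theorem inner_constOne (f : H2) : ⟪constOne, f⟫_ℂ = f 0 := by
  have h : ⟪constOne, f⟫_ℂ = ⟪coeff constOne, coeff f⟫_ℂ := rfl
  rw [h, coeff_constOne, lp.inner_single_left, coeff_zero]
  simp

theorem norm_apply_le (f : H2) (z : 𝔻) : ‖f z‖ ≤ ‖f‖ * (1 - ‖(z : ℂ)‖)⁻¹ := by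
  rw [← (hasSum f z).tsum_eq]
  refine tsum_of_norm_bounded
    ((hasSum_geometric_of_lt_one (norm_nonneg _) z.norm_lt_one).mul_left ‖f‖) fun n => ?_
  rw [norm_mul, norm_pow, norm_eq]
  gcongr
  exact norm_coeff_le _ n

end H2

/-- A form of the maximum principle: all powers `φⁿ` have norm `1` in `H²`, so they are bounded at
each point of the disc. -/
theorem norm_le_one_of_isInner {φ : ℂ → ℂ} (hφ : IsInner φ) {z : ℂ} (hz : z ∈ ball (0 : ℂ) 1) :
    ‖φ z‖ ≤ 1 := by
  have hz' : ‖z‖ < 1 := by simpa using hz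
  let w : 𝔻 := Complex.UnitDisc.mk z hz'
  have hpow : ∀ n : ℕ, ‖((toeplitz φ hφ.1) ^ n) H2.constOne‖ = 1 ∧
      (((toeplitz φ hφ.1) ^ n) H2.constOne) w = φ z ^ n := by
    intro n
    induction n with
    | zero => exact ⟨H2.norm_constOne, by simpa using H2.constOne_apply w⟩
    | succ n ih =>
      rw [pow_succ', mul_apply_eq_comp, norm_toeplitz_of_isInner hφ, toeplitz_apply, ih.1, ih.2,
        pow_succ']
      exact ⟨rfl, rfl⟩
  by_contra! h
  obtain ⟨n, hn⟩ := pow_unbounded_of_one_lt ((1 - ‖z‖)⁻¹) h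
  have h1 := H2.norm_apply_le (((toeplitz φ hφ.1) ^ n) H2.constOne) w
  rw [(hpow n).1, (hpow n).2, one_mul, norm_pow] at h1
  exact (hn.trans_le h1).false

theorem norm_toeplitz_le_of_isHolomorphicSelfMap {ψ : ℂ → ℂ} (hψ : IsHolomorphicSelfMap ψ)
    (f : H2) : ‖toeplitz ψ hψ.isBoundedHolomorphic f‖ ≤ ‖f‖ := by
  obtain ⟨g, hg, hn⟩ := exists_mul hψ.1 (M := 1)
    (fun z hz => (mem_ball_zero_iff.1 (hψ.2 hz)).le) f
  rw [show toeplitz ψ hψ.isBoundedHolomorphic f = g from H2.ext fun z => (hg z).symm]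
  simpa using hn

theorem isIntertwinedWith_of_apply_zero {φ ψ : ℂ → ℂ} (hφ : IsInner φ)
    (hφ_nonconst : ¬ ∃ c : ℂ, ∀ z ∈ ball (0 : ℂ) 1, φ z = c)
    (hψ : IsHolomorphicSelfMap ψ) (hψ0 : ψ 0 = 0) :
    IsIntertwinedWith (toeplitz φ hφ.1) (toeplitz ψ hψ.isBoundedHolomorphic) := by
  set V := toeplitz φ hφ.1 with hVdef
  have hV : ∀ f, ‖V f‖ = ‖f‖ := norm_toeplitz_of_isInner hφ
  -- Both `⟪1, φ f⟫` and `⟪conj (φ 0) φ, φ f⟫` equal `φ 0 * f 0`, the latter as `V` is isometric.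
  set e : H2 := H2.constOne - conj (φ 0) • V H2.constOne with he
  have hVe : ∀ f, ⟪e, V f⟫_ℂ = 0 := by
    intro f
    have h1 : ⟪V H2.constOne, V f⟫_ℂ = ⟪H2.constOne, f⟫_ℂ :=
      LinearIsometry.inner_map_map ⟨V.toLinearMap, hV⟩ _ f
    rw [he, inner_sub_left, inner_smul_left, h1, H2.inner_constOne, H2.inner_constOne,
      Complex.conj_conj, hVdef, toeplitz_apply, Complex.UnitDisc.coe_zero, sub_self]
  have he0 : e ≠ 0 := by
    intro h0
    refine hφ_nonconst ⟨(conj (φ 0))⁻¹, fun z hz => ?_⟩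
    have hz' : ‖z‖ < 1 := by simpa using hz
    have h1 : H2.constOne = conj (φ 0) • V H2.constOne := sub_eq_zero.1 h0
    have h2 : H2.constOne (Complex.UnitDisc.mk z hz') =
        (conj (φ 0) • V H2.constOne) (Complex.UnitDisc.mk z hz') :=
      congrArg (fun g : H2 => g (Complex.UnitDisc.mk z hz')) h1
    rw [H2.smul_apply, hVdef, toeplitz_apply, H2.constOne_apply, mul_one] at h2
    exact eq_inv_of_mul_eq_one_right h2.symm
  have hen : ‖((‖e‖⁻¹ : ℝ) : ℂ) • e‖ = 1 := by
    rw [norm_smul, Complex.norm_real, norm_inv, norm_norm,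
      inv_mul_cancel₀ (norm_ne_zero_iff.2 he0)]
  obtain ⟨X, hX, hXe⟩ := exists_intertwining_of_wandering V
    (toeplitz ψ hψ.isBoundedHolomorphic) hV hen
    (fun f => by rw [inner_smul_left, hVe, mul_zero])
    (norm_toeplitz_le_of_isHolomorphicSelfMap hψ) H2.norm_constOne.le
    (fun f => by
      rw [H2.inner_constOne, toeplitz_apply, Complex.UnitDisc.coe_zero, hψ0, zero_mul])
  refine ⟨X, hX, fun h => ?_⟩
  have h1 := H2.norm_constOne
  rw [← hXe, h, zero_apply, norm_zero] at h1
  exact zero_ne_one h1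

/-! ### Disc automorphisms -/

/-- The automorphism `w ↦ (w - a) / (1 - ā w)` of the unit disc, which carries `a` to `0`. -/
noncomputable def discAut (a w : ℂ) : ℂ := (w - a) / (1 - conj a * w)

theorem norm_conj_mul_lt_one {a w : ℂ} (ha : ‖a‖ < 1) (hw : ‖w‖ ≤ 1) : ‖conj a * w‖ < 1 := by
  rw [norm_mul, RCLike.norm_conj]
  exact (mul_le_of_le_one_right (norm_nonneg _) hw).trans_lt ha

theorem one_sub_conj_mul_ne_zero {a w : ℂ} (ha : ‖a‖ < 1) (hw : ‖w‖ ≤ 1) :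
    1 - conj a * w ≠ 0 := by
  intro h
  have h1 := norm_conj_mul_lt_one ha hw
  rw [← sub_eq_zero.1 h, norm_one] at h1
  exact h1.false

/-- The identity behind the fact that `discAut a` preserves the disc and its boundary circle. -/
theorem norm_sq_sub_norm_sq (a w : ℂ) :
    ‖1 - conj a * w‖ ^ 2 - ‖w - a‖ ^ 2 = (1 - ‖a‖ ^ 2) * (1 - ‖w‖ ^ 2) := by
  simp only [← Complex.normSq_eq_norm_sq, Complex.normSq_apply, Complex.sub_re, Complex.sub_im,
    Complex.mul_re, Complex.mul_im, Complex.conj_re, Complex.conj_im, Complex.one_re,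
    Complex.one_im]
  ring

theorem one_sub_norm_sq_pos {a : ℂ} (ha : ‖a‖ < 1) : 0 < 1 - ‖a‖ ^ 2 := by
  nlinarith [norm_nonneg a]

theorem norm_discAut_lt_one {a w : ℂ} (ha : ‖a‖ < 1) (hw : ‖w‖ < 1) : ‖discAut a w‖ < 1 := by
  have h := norm_sq_sub_norm_sq a w
  have h1 := mul_pos (one_sub_norm_sq_pos ha) (one_sub_norm_sq_pos hw)
  rw [discAut, norm_div, div_lt_one (norm_pos_iff.2 (one_sub_conj_mul_ne_zero ha hw.le))]
  exact lt_of_pow_lt_pow_left₀ 2 (norm_nonneg _) (by linarith)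

theorem norm_discAut_eq_one {a w : ℂ} (ha : ‖a‖ < 1) (hw : ‖w‖ = 1) : ‖discAut a w‖ = 1 := by
  have h := norm_sq_sub_norm_sq a w
  rw [hw, one_pow, sub_self, mul_zero, sub_eq_zero, sq_eq_sq₀ (norm_nonneg _) (norm_nonneg _)] at h
  rw [discAut, norm_div, ← h, div_self]
  exact norm_ne_zero_iff.2 (one_sub_conj_mul_ne_zero ha hw.le)

theorem norm_discAut_le_one {a w : ℂ} (ha : ‖a‖ < 1) (hw : ‖w‖ ≤ 1) : ‖discAut a w‖ ≤ 1 :=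
  hw.lt_or_eq.elim (fun h => (norm_discAut_lt_one ha h).le) fun h => (norm_discAut_eq_one ha h).le

theorem discAut_self (a : ℂ) : discAut a a = 0 := by
  rw [discAut, sub_self, zero_div]

/-- The relation between `w` and `discAut a w` solved for `w`, in a form without denominators that
carries over to Toeplitz operators. -/
theorem discAut_add {a w : ℂ} (ha : ‖a‖ < 1) (hw : ‖w‖ ≤ 1) :
    discAut a w + a = w * (1 + conj a * discAut a w) := by
  have h : discAut a w * (1 - conj a * w) = w - a :=
    div_mul_cancel₀ _ (one_sub_conj_mul_ne_zero ha hw)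
  linear_combination h

theorem one_add_conj_mul_discAut {a w : ℂ} (ha : ‖a‖ < 1) (hw : ‖w‖ ≤ 1) :
    (1 + conj a * discAut a w) * (1 - conj a * w) = 1 - conj a * a := by
  have := one_sub_conj_mul_ne_zero ha hw
  rw [discAut]
  field_simp
  ring

theorem one_add_conj_mul_discAut_ne_zero {a w : ℂ} (ha : ‖a‖ < 1) (hw : ‖w‖ ≤ 1) :
    1 + conj a * discAut a w ≠ 0 := by
  refine left_ne_zero_of_mul (b := 1 - conj a * w) ?_
  rw [one_add_conj_mul_discAut ha hw]
  exact one_sub_conj_mul_ne_zero ha ha.le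

theorem differentiableOn_discAut_comp {a : ℂ} (ha : ‖a‖ < 1) {φ : ℂ → ℂ}
    (hd : DifferentiableOn ℂ φ (ball 0 1)) (hφ : ∀ z ∈ ball (0 : ℂ) 1, ‖φ z‖ ≤ 1) :
    DifferentiableOn ℂ (fun z => discAut a (φ z)) (ball 0 1) :=
  (hd.sub_const a).div ((differentiableOn_const 1).sub (hd.const_mul _)) fun z hz =>
    one_sub_conj_mul_ne_zero ha (hφ z hz)

theorem IsInner.discAut_comp {a : ℂ} (ha : ‖a‖ < 1) {φ : ℂ → ℂ} (hφ : IsInner φ) :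
    IsInner fun z => discAut a (φ z) := by
  have hle := fun z (hz : z ∈ ball (0 : ℂ) 1) => norm_le_one_of_isInner hφ hz
  refine ⟨⟨differentiableOn_discAut_comp ha hφ.1.1 hle, 1, fun z hz =>
    norm_discAut_le_one ha (hle z hz)⟩, ?_⟩
  filter_upwards [hφ.2] with θ hθ
  obtain ⟨w, hw, ht⟩ := hθ
  exact ⟨discAut a w, norm_discAut_eq_one ha hw,
    (ht.sub_const a).div (tendsto_const_nhds.sub (ht.const_mul _))
      (one_sub_conj_mul_ne_zero ha hw.le)⟩

theorem IsHolomorphicSelfMap.discAut_comp {a : ℂ} (ha : ‖a‖ < 1) {ψ : ℂ → ℂ}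
    (hψ : IsHolomorphicSelfMap ψ) : IsHolomorphicSelfMap fun z => discAut a (ψ z) := by
  have hlt := fun z (hz : z ∈ ball (0 : ℂ) 1) => mem_ball_zero_iff.1 (hψ.2 hz)
  exact ⟨differentiableOn_discAut_comp ha hψ.1 fun z hz => (hlt z hz).le, fun z hz =>
    mem_ball_zero_iff.2 (norm_discAut_lt_one ha (hlt z hz))⟩

theorem toeplitz_discAut_add {a : ℂ} (ha : ‖a‖ < 1) {φ : ℂ → ℂ} (hφ : IsBoundedHolomorphic φ)
    (hle : ∀ z ∈ ball (0 : ℂ) 1, ‖φ z‖ ≤ 1)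
    (hφ' : IsBoundedHolomorphic fun z => discAut a (φ z)) (f : H2) :
    toeplitz _ hφ' f + a • f = toeplitz φ hφ (f + conj a • toeplitz _ hφ' f) := by
  ext z
  have h := discAut_add ha (hle z (by simpa using z.norm_lt_one))
  simp only [H2.add_apply, H2.smul_apply, toeplitz_apply]
  linear_combination f z * h

/-- The operator `1 + ā T_{b ∘ φ}` is onto, where `b = discAut a`: up to the scalar `1 - |a|²`, the
operator `1 - ā T_φ` is a right inverse. -/
theorem exists_add_toeplitz_discAut_eq {a : ℂ} (ha : ‖a‖ < 1) {φ : ℂ → ℂ}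
    (hφ : IsBoundedHolomorphic φ) (hle : ∀ z ∈ ball (0 : ℂ) 1, ‖φ z‖ ≤ 1)
    (hφ' : IsBoundedHolomorphic fun z => discAut a (φ z)) (f : H2) :
    ∃ g : H2, g + conj a • toeplitz _ hφ' g = f := by
  refine ⟨(1 - conj a * a)⁻¹ • (f + (-conj a) • toeplitz φ hφ f), ?_⟩
  ext z
  have h := one_add_conj_mul_discAut ha (hle z (by simpa using z.norm_lt_one))
  have h0 := one_sub_conj_mul_ne_zero ha ha.le
  simp only [H2.add_apply, H2.smul_apply, toeplitz_apply]
  field_simp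
  linear_combination f z * h

/-- With `b = discAut a`, one has `T_{b ∘ φ} + a = T_φ (1 + ā T_{b ∘ φ})`, where the last factor is
onto, and likewise for `ψ`; so an operator that intertwines `T_{b ∘ φ}` and `T_{b ∘ ψ}` intertwines
`T_φ` and `T_ψ`. -/
theorem intertwines_of_discAut {a : ℂ} (ha : ‖a‖ < 1) {φ ψ : ℂ → ℂ}
    (hφ : IsBoundedHolomorphic φ) (hφle : ∀ z ∈ ball (0 : ℂ) 1, ‖φ z‖ ≤ 1)
    (hφ' : IsBoundedHolomorphic fun z => discAut a (φ z))
    (hψ : IsBoundedHolomorphic ψ) (hψle : ∀ z ∈ ball (0 : ℂ) 1, ‖ψ z‖ ≤ 1)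
    (hψ' : IsBoundedHolomorphic fun z => discAut a (ψ z)) {X : H2 →L[ℂ] H2}
    (hX : Intertwines X (toeplitz _ hφ') (toeplitz _ hψ')) :
    Intertwines X (toeplitz φ hφ) (toeplitz ψ hψ) := by
  refine ⟨?_, hX.2⟩
  have hc : ∀ f, X (toeplitz _ hφ' f) = toeplitz _ hψ' (X f) := fun f => DFunLike.congr_fun hX.1 f
  ext1 f
  obtain ⟨g, rfl⟩ := exists_add_toeplitz_discAut_eq ha hφ hφle hφ' f
  rw [ContinuousLinearMap.comp_apply, ContinuousLinearMap.comp_apply,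
    ← toeplitz_discAut_add ha hφ hφle hφ', map_add, map_add, map_smul, map_smul, hc,
    toeplitz_discAut_add ha hψ hψle hψ']

theorem not_const_discAut_comp {a : ℂ} (ha : ‖a‖ < 1) {φ : ℂ → ℂ}
    (hle : ∀ z ∈ ball (0 : ℂ) 1, ‖φ z‖ ≤ 1)
    (hφ : ¬ ∃ c : ℂ, ∀ z ∈ ball (0 : ℂ) 1, φ z = c) :
    ¬ ∃ c : ℂ, ∀ z ∈ ball (0 : ℂ) 1, discAut a (φ z) = c := by
  rintro ⟨c, hc⟩
  refine hφ ⟨(c + a) / (1 + conj a * c), fun z hz => ?_⟩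
  rw [← hc z hz, discAut_add ha (hle z hz),
    mul_div_cancel_right₀ _ (one_add_conj_mul_discAut_ne_zero ha (hle z hz))]

end Hardy

theorem theorem5p1 (φ ψ : ℂ → ℂ) (hφ : Hardy.IsInner φ)
    (hφ_nonconst : ¬ ∃ c : ℂ, ∀ z ∈ Metric.ball (0 : ℂ) 1, φ z = c)
    (hψ : Hardy.IsHolomorphicSelfMap ψ) :
    Hardy.IsIntertwinedWith (Hardy.toeplitz φ hφ.1)
      (Hardy.toeplitz ψ hψ.isBoundedHolomorphic) := by
  have ha : ‖ψ 0‖ < 1 := mem_ball_zero_iff.1 (hψ.2 (mem_ball_self one_pos))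
  have hφle := fun z (hz : z ∈ ball (0 : ℂ) 1) => Hardy.norm_le_one_of_isInner hφ hz
  have hψle := fun z (hz : z ∈ ball (0 : ℂ) 1) => (mem_ball_zero_iff.1 (hψ.2 hz)).le
  obtain ⟨X, hX⟩ := Hardy.isIntertwinedWith_of_apply_zero (hφ.discAut_comp ha)
    (Hardy.not_const_discAut_comp ha hφle hφ_nonconst) (hψ.discAut_comp ha)
    (Hardy.discAut_self (ψ 0))
  exact ⟨X, Hardy.intertwines_of_discAut ha _ hφle _ _ hψle _ hX⟩
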